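/- Consider $n$ servers $S_1,\dots,S_n$ with periods $P_i>0$, bandwidths $U_i>0$ and maximum budgets $Q_i=U_iP_i$. Server $S_i$ serves, in order of arrival, a task that is an arbitrary finite or infinite sequence of jobs with (nondecreasing, nonnegative) arrival times and nonnegative computation times. The servers are scheduled on $m\ge 1$ identical unit-speed processors by preemptive global EDF with migration: at each instant the (at most $m$) ActiveContending servers with the earliest server deadlines execute, ties being broken arbitrarily. Each server has a state, a budget $q_i$ and a deadline $d_i$; there is one global variable $U_{\mathsf{inact}}$. At time $0$ all servers are Inactive and $U_{\mathsf{inact}}$ has an initial value $u_0$. The rules (parallel reclaiming) are: 1. If a job arrives at time $t$ and $S_i$ is Inactive, then $S_i$ becomes ActiveContending, $q_i\leftarrow Q_i$, $d_i\leftarrow t+P_i$, $U_{\mathsf{inact}}\leftarrow U_{\mathsf{inact}}-U_i$. 2. When a job of $S_i$ completes, $S_i$ remains ActiveContending with unchanged variables if another job is ready, and becomes ActiveNonContending otherwise. If $q_i$ reaches $0$ while a job is unfinished, $S_i$ becomes Recharging and does not execute. 3. When $t=d_i$ for a Recharging server, $d_i\leftarrow d_i+P_i$, $q_i\leftarrow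 Q_i$, and $S_i$ becomes ActiveContending. 4. If a job arrives while $S_i$ is ActiveNonContending, $S_i$ becomes ActiveContending with unchanged variables. (A job that arrives while $S_i$ is ActiveContending or Recharging is queued.) 5. $S_i$ remains ActiveNonContending only while $q_i<(d_i-t)U_i$; when $q_i\ge(d_i-t)U_i$ it becomes Inactive and $U_{\mathsf{inact}}\leftarrow U_{\mathsf{inact}}+U_i$. While $S_i$ executes, $dq_i=-\max\{U_i,\,1-U_{\mathsf{inact}}/m\}\,dt$; otherwise $q_i$ does not change with time. Each application of rule 1 or rule 3 releases a new server job of $S_i$, whose scheduling deadline is the new value of $d_i$. Let $U=\sum_i U_i$ and $U_{\mathsf{max}}=\max_i U_i$. Suppose that $$U\le m-(m-1)U_{\mathsf{max}},$$ and that the initial value $u_0$ of $U_{\mathsf{inact}}$ is any real number with $u_0\le m-(m-1)U_{\mathsf{max}}$ (for instance $u_0=0$; or $u_0=U$, the total bandwidth of the initially inactive servers; or the largest value, which is $U$ plus the spare bandwidth $m-(m-1)U_{\mathsf{max}}-U$). Then, in every execution, every server job meets its scheduling deadline: whenever $S_i$ is ActiveContending at time $t$, one has $t\le d_i$, and $t<d_i$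 if $q_i>0$. -/

import Mathlib

namespace ParRecl

/-- A family of `n` servers: server `i` has period `P i` and bandwidth (utilisation) `U i`. -/
structure Servers (n : ℕ) where
  P : Fin n → ℝ
  U : Fin n → ℝ
  P_pos : ∀ i, 0 < P i
  U_pos : ∀ i, 0 < U i

namespace Servers

variable {n : ℕ}

/-- The maximum budget `Q i = U i * P i`. -/
def Q (S : Servers n) (i : Fin n) : ℝ := S.U i * S.P i

/-- The total bandwidth `U` of all servers. -/
noncomputable def total (S : Servers n) : ℝ := ∑ i, S.U i

/-- The largest bandwidth `U_max` of a server. -/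
noncomputable def maxU (S : Servers n) : ℝ := ⨆ i, S.U i

/-- The utilisation test of Goossens, Funk and Baruah for `m` processors. -/
def GFB (S : Servers n) (m : ℕ) : Prop :=
  S.total ≤ (m : ℝ) - ((m : ℝ) - 1) * S.maxU

end Servers

/-- A real-time task: a finite or infinite sequence of jobs. Job `k` (for `k < count`) arrives at
time `arrival k` and needs `comp k` units of computation time. No periodicity is assumed. The
deadlines of the jobs themselves play no role for the scheduler and are left out. -/
structure Task where
  count : ℕ∞
  arrival : ℕ → ℝ
  comp : ℕ → ℝ
  arrival_nonneg : ∀ k, 0 ≤ arrival k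
  arrival_mono : Monotone arrival
  comp_nonneg : ∀ k, 0 ≤ comp k

/-- The states of a server. -/
inductive Mode where
  | activeContending
  | activeNonContending
  | inactive
  | recharging

/-- A configuration of the whole system at one instant. -/
structure Config (n : ℕ) where
  /-- current time -/
  now : ℝ
  /-- the state of each server -/
  mode : Fin n → Mode
  /-- the server budget `q_i` -/
  budget : Fin n → ℝ
  /-- the server deadline `d_i` -/
  deadline : Fin n → ℝ
  /-- remaining computation times of the arrived, not yet completed jobs, in order of arrival -/
  queue : Fin n → List ℝ
  /-- number of jobs of each task that have arrived so far -/
  released : Fin n → ℕ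
  /-- the global variable `U_inact` -/
  uInact : ℝ

variable {n : ℕ}

/-- Initially (time `0`) all servers are inactive, no job has arrived, and `U_inact = u₀`.
Budgets and deadlines are irrelevant until a server is activated. -/
def Initial (u₀ : ℝ) (c : Config n) : Prop :=
  c.now = 0 ∧ (∀ i, c.mode i = Mode.inactive) ∧ (∀ i, c.queue i = []) ∧
    (∀ i, c.released i = 0) ∧ c.uInact = u₀

/-- `R` is a set of servers that global EDF may execute on `m` identical processors: at most `m`
servers, all of them contending, and if some contending server is left out, then all
processors are busy with servers whose deadlines are not later (ties are broken arbitrarily). -/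
def IsGEDF (m : ℕ) (c : Config n) (R : Finset (Fin n)) : Prop :=
  R.card ≤ m ∧ (∀ i ∈ R, c.mode i = Mode.activeContending) ∧
    ∀ i, c.mode i = Mode.activeContending → i ∉ R →
      R.card = m ∧ ∀ j ∈ R, c.deadline j ≤ c.deadline i

/-- The rate at which the budget of the executing server `i` decreases under parallel
reclaiming. -/
noncomputable def rate (S : Servers n) (m : ℕ) (c : Config n) (i : Fin n) : ℝ :=
  max (S.U i) (1 - c.uInact / (m : ℝ))

/-- `MayElapse S τ m c R δ`: with the servers in `R` executing, no event (job arrival, job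
completion, budget exhaustion, end of recharging, deactivation) has to be handled at any time in
`[now, now + δ)`. -/
def MayElapse (S : Servers n) (τ : Fin n → Task) (m : ℕ) (c : Config n) (R : Finset (Fin n))
    (δ : ℝ) : Prop :=
  0 < δ ∧
  (∀ i, (c.released i : ℕ∞) < (τ i).count → c.now + δ ≤ (τ i).arrival (c.released i)) ∧
  (∀ i, c.mode i = Mode.activeContending →
    0 < c.budget i ∧ ∃ r rest, c.queue i = r :: rest ∧ 0 < r) ∧
  (∀ i ∈ R, rate S m c i * δ ≤ c.budget i ∧ ∀ r rest, c.queue i = r :: rest → δ ≤ r) ∧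
  (∀ i, c.mode i = Mode.activeNonContending →
    c.budget i ≤ (c.deadline i - (c.now + δ)) * S.U i) ∧
  (∀ i, c.mode i = Mode.recharging → c.now + δ ≤ c.deadline i)

/-- The configuration after `δ` time units during which exactly the servers in `R` execute. -/
noncomputable def elapse (S : Servers n) (m : ℕ) (c : Config n) (R : Finset (Fin n)) (δ : ℝ) :
    Config n :=
  { c with
    now := c.now + δ
    budget := fun i => if i ∈ R then c.budget i - rate S m c i * δ else c.budget i
    queue := fun i => if i ∈ R then (c.queue i).modifyHead (fun r => r - δ) else c.queue i }

/-- The next job of task `i` arrives now. -/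
def Arrives (τ : Fin n → Task) (c : Config n) (i : Fin n) : Prop :=
  (c.released i : ℕ∞) < (τ i).count ∧ c.now = (τ i).arrival (c.released i)

/-- Put the next job of task `i` into the queue of server `i`. -/
def enqueue (τ : Fin n → Task) (c : Config n) (i : Fin n) : Config n :=
  { c with
    queue := Function.update c.queue i (c.queue i ++ [(τ i).comp (c.released i)])
    released := Function.update c.released i (c.released i + 1) }

/-- The steps of the system: one instantaneous rule for one server, or the passage of time. -/
inductive Step (S : Servers n) (τ : Fin n → Task) (m : ℕ) : Config n → Config n → Prop
  /-- A job arrives at an inactive server: the server becomes contending with a fresh budget and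
  deadline (release of a new server job), and `U_inact` is decremented. -/
  | activate (c : Config n) (i : Fin n) (ha : Arrives τ c i) (hs : c.mode i = Mode.inactive) :
      Step S τ m c
        { enqueue τ c i with
          mode := Function.update c.mode i Mode.activeContending
          budget := Function.update c.budget i (S.Q i)
          deadline := Function.update c.deadline i (c.now + S.P i)
          uInact := c.uInact - S.U i }
  /-- A job arrives at a non-contending server: it becomes contending, variables unchanged. -/
  | resume (c : Config n) (i : Fin n) (ha : Arrives τ c i)
      (hs : c.mode i = Mode.activeNonContending) :
      Step S τ m c
        { enqueue τ c i with mode := Function.update c.mode i Mode.activeContending }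
  /-- A job arrives at a contending or recharging server: it is queued. -/
  | queueUp (c : Config n) (i : Fin n) (ha : Arrives τ c i)
      (hs : c.mode i = Mode.activeContending ∨ c.mode i = Mode.recharging) :
      Step S τ m c (enqueue τ c i)
  /-- A job completes and another one is ready: the server remains contending. -/
  | completeNext (c : Config n) (i : Fin n) (r : ℝ) (rest : List ℝ)
      (hs : c.mode i = Mode.activeContending) (hq : c.queue i = 0 :: r :: rest) :
      Step S τ m c { c with queue := Function.update c.queue i (r :: rest) }
  /-- A job completes and no other one is ready: the server becomes non-contending. -/
  | completeLast (c : Config n) (i : Fin n)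
      (hs : c.mode i = Mode.activeContending) (hq : c.queue i = [0]) :
      Step S τ m c
        { c with
          queue := Function.update c.queue i []
          mode := Function.update c.mode i Mode.activeNonContending }
  /-- The budget is exhausted while a job is still unfinished. -/
  | exhaust (c : Config n) (i : Fin n) (r : ℝ) (rest : List ℝ)
      (hs : c.mode i = Mode.activeContending) (hq : c.queue i = r :: rest) (hr : 0 < r)
      (hb : c.budget i = 0) :
      Step S τ m c { c with mode := Function.update c.mode i Mode.recharging }
  /-- At its deadline a recharging server gets a full budget, its deadline is postponed by one
  period, and it is contending again (release of a new server job). -/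
  | recharge (c : Config n) (i : Fin n) (hs : c.mode i = Mode.recharging)
      (hd : c.deadline i ≤ c.now) :
      Step S τ m c
        { c with
          mode := Function.update c.mode i Mode.activeContending
          budget := Function.update c.budget i (S.Q i)
          deadline := Function.update c.deadline i (c.deadline i + S.P i) }
  /-- A non-contending server with `q_i ≥ (d_i - t) U_i` becomes inactive, and `U_inact` is
  incremented. -/
  | deactivate (c : Config n) (i : Fin n) (hs : c.mode i = Mode.activeNonContending)
      (hb : (c.deadline i - c.now) * S.U i ≤ c.budget i) :
      Step S τ m c
        { c with
          mode := Function.update c.mode i Mode.inactive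
          uInact := c.uInact + S.U i }
  /-- Time passes while a set of servers chosen by global EDF executes. -/
  | run (c : Config n) (R : Finset (Fin n)) (δ : ℝ) (hR : IsGEDF m c R)
      (hδ : MayElapse S τ m c R δ) :
      Step S τ m c (elapse S m c R δ)

/-- `c` occurs in some execution of the system in which `U_inact` is initialised to `u₀`. Any
time span between two events may be split, so every instant of an execution is covered. -/
def Reachable (S : Servers n) (τ : Fin n → Task) (m : ℕ) (u₀ : ℝ) (c : Config n) : Prop :=
  ∃ c₀, Initial u₀ c₀ ∧ Relation.ReflTransGen (Step S τ m) c₀ c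

/-- The current server job of server `i` does not violate its deadline `d_i` in configuration
`c`: if the server still has unserved jobs and has not been moved to recharging, then the deadline
has not passed, and it has not even been reached unless the budget is used up. -/
def MeetsDeadline (c : Config n) (i : Fin n) : Prop :=
  c.mode i = Mode.activeContending →
    c.now ≤ c.deadline i ∧ (0 < c.budget i → c.now < c.deadline i)

end ParRecl

namespace ParRecl

/-! ### Lags, the invariant, and why it keeps deadlines -/

variable {n : ℕ}

/-! Compare each active server with a fluid schedule of rate `U i`: its lag is `q_i - (d_i - t)
U_i`. Let `L(D)` be the total lag of the active servers with deadline at most `D`. The core of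
`Balanced` is `L(D) + (m-1) lag_k ≤ 0` whenever `k` is active and `d_k ≤ D`. It forces `L(D) ≤ 0`.
At `D = t`, with no deadline passed, the lags counted are the nonnegative budgets of the servers due
now, so these budgets vanish.

Let `A` be the active bandwidth. As `U_inact = u₀ - A`, the bound on `u₀` makes every rate at least
`(A + (m-1) U_max) / m` (`Balanced.le_mul_rate`). For contending `k`, the weighted sum gains at most
`A + (m-1) U_k` per unit of time. It loses `m` times the rate of `k` if `k` runs, and otherwise the
rates of `m` servers with deadlines at most `d_k`; both cover the gain (`Balanced.lag_elapse_le`).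
Releases add zero lag, deactivation removes nonnegative lag, and the other instantaneous rules keep
all lags. `Balanced.now_add_le` excludes a run that jumps over a deadline. -/

/-- A server is active if it is in any state other than `inactive`. -/
def Active (c : Config n) (i : Fin n) : Prop := c.mode i ≠ Mode.inactive

/-- The amount by which the budget of server `i` exceeds the budget left by a fluid schedule that
serves `i` at the constant rate `U i` up to its deadline. -/
def lag (S : Servers n) (c : Config n) (i : Fin n) : ℝ :=
  c.budget i - (c.deadline i - c.now) * S.U i

open Classical in
/-- The total lag of the active servers with deadline at most `D`. -/
noncomputable def lagUpTo (S : Servers n) (c : Config n) (D : ℝ) : ℝ :=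
  ∑ i, if Active c i ∧ c.deadline i ≤ D then lag S c i else 0

open Classical in
/-- The total bandwidth of the active servers. -/
noncomputable def activeU (S : Servers n) (c : Config n) : ℝ :=
  ∑ i, if Active c i then S.U i else 0

open Classical in
theorem activeU_congr {S : Servers n} {c c' : Config n} (h : ∀ i, Active c' i ↔ Active c i) :
    activeU S c' = activeU S c :=
  Finset.sum_congr rfl fun i _ => if_congr (h i) rfl rfl

/-- The invariant of parallel reclaiming: the lag of every active server, weighted by `m - 1`, is
compensated by the total lag of the active servers with deadlines up to any later bound. -/
structure Balanced (S : Servers n) (m : ℕ) (u₀ : ℝ) (c : Config n) : Prop where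
  budget_nonneg : ∀ i, Active c i → 0 ≤ c.budget i
  budget_recharging : ∀ i, c.mode i = Mode.recharging → c.budget i = 0
  now_le : ∀ i, Active c i → c.now ≤ c.deadline i
  uInact_eq : c.uInact = u₀ - activeU S c
  lag_le : ∀ D k, Active c k → c.deadline k ≤ D →
    lagUpTo S c D + ((m : ℝ) - 1) * lag S c k ≤ 0

/-- A counted server of positive lag lets its weighted term be dropped; if there is none, every
summand is nonpositive. Asking only for positive lags means that, after a run, only contending
servers need checking. -/
theorem lagUpTo_nonpos_of_forall {S : Servers n} {m : ℕ} (hm : 1 ≤ m) {c : Config n} {D : ℝ}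
    (h : ∀ k, Active c k → c.deadline k ≤ D → 0 < lag S c k →
      lagUpTo S c D + ((m : ℝ) - 1) * lag S c k ≤ 0) :
    lagUpTo S c D ≤ 0 := by
  have hm' : (1 : ℝ) ≤ m := by exact_mod_cast hm
  by_cases hex : ∃ k, Active c k ∧ c.deadline k ≤ D ∧ 0 < lag S c k
  · obtain ⟨k, hk, hkD, hpos⟩ := hex
    have := mul_nonneg (sub_nonneg.2 hm') hpos.le
    linarith [h k hk hkD hpos]
  · push Not at hex
    refine Finset.sum_nonpos fun k _ => ?_
    split_ifs with hk
    · exact hex k hk.1 hk.2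
    · exact le_rfl

theorem Balanced.lagUpTo_nonpos {S : Servers n} {m : ℕ} (hm : 1 ≤ m) {u₀ : ℝ} {c : Config n}
    (h : Balanced S m u₀ c) (D : ℝ) : lagUpTo S c D ≤ 0 :=
  lagUpTo_nonpos_of_forall hm fun k hk hkD _ => h.lag_le D k hk hkD

/-- If the total lag up to the current time is not positive and no deadline has passed, then all
servers whose deadline is now have used up their budgets. -/
theorem budget_nonpos_of_lagUpTo_nonpos {S : Servers n} {c : Config n}
    (hb : ∀ i, Active c i → 0 ≤ c.budget i)
    (hd : ∀ i, Active c i → c.now ≤ c.deadline i) (hL : lagUpTo S c c.now ≤ 0)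
    {k : Fin n} (hk : Active c k) (hkd : c.deadline k = c.now) : c.budget k ≤ 0 := by
  classical
  refine le_trans ?_ hL
  -- Counted deadlines equal the current time, so the fluid part of the lag is zero.
  have hterm : ∀ i, Active c i ∧ c.deadline i ≤ c.now → lag S c i = c.budget i := by
    rintro i ⟨hi, hiD⟩
    have : c.deadline i = c.now := le_antisymm hiD (hd i hi)
    simp [lag, this]
  have hk' : Active c k ∧ c.deadline k ≤ c.now := ⟨hk, hkd.le⟩
  have hle := Finset.single_le_sum
    (f := fun i => if Active c i ∧ c.deadline i ≤ c.now then lag S c i else 0)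
    (s := Finset.univ) (fun i _ => by
      split_ifs with hi
      · rw [hterm i hi]; exact hb i hi.1
      · exact le_rfl) (Finset.mem_univ k)
  rw [if_pos hk', hterm k hk'] at hle
  exact hle.trans (le_of_eq (Finset.sum_congr rfl fun i _ => by congr))

theorem Balanced.meetsDeadline {S : Servers n} {m : ℕ} (hm : 1 ≤ m) {u₀ : ℝ} {c : Config n}
    (h : Balanced S m u₀ c) (i : Fin n) : MeetsDeadline c i := by
  intro hi
  have ha : Active c i := by simp [Active, hi]
  refine ⟨h.now_le i ha, fun hb => lt_of_le_of_ne (h.now_le i ha) fun he => ?_⟩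
  exact absurd (budget_nonpos_of_lagUpTo_nonpos h.budget_nonneg h.now_le
    (h.lagUpTo_nonpos hm _) ha he.symm) (not_le.2 hb)

/-! ### The initial state and the instantaneous rules -/

open Classical in
theorem Balanced.congr {S : Servers n} {m : ℕ} {u₀ : ℝ} {c c' : Config n}
    (h : Balanced S m u₀ c) (hnow : c'.now = c.now) (hbud : c'.budget = c.budget)
    (hdl : c'.deadline = c.deadline) (hu : c'.uInact = c.uInact)
    (hact : ∀ i, Active c' i ↔ Active c i)
    (hrech : ∀ i, c'.mode i = Mode.recharging → c.budget i = 0) : Balanced S m u₀ c' := by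
  have hlag : ∀ i, lag S c' i = lag S c i := fun i => by simp [lag, hnow, hbud, hdl]
  constructor
  · intro i hi; rw [hbud]; exact h.budget_nonneg i ((hact i).1 hi)
  · intro i hi; rw [hbud]; exact hrech i hi
  · intro i hi; rw [hnow, hdl]; exact h.now_le i ((hact i).1 hi)
  · rw [hu, h.uInact_eq]; rw [activeU_congr hact]
  · intro D k hk hkD
    have hsum : lagUpTo S c' D = lagUpTo S c D := Finset.sum_congr rfl fun i _ =>
      if_congr (by rw [hact, hdl]) (hlag i) rfl
    have := h.lag_le D k ((hact k).1 hk) (by rwa [hdl] at hkD)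
    rwa [hsum, hlag]

theorem Initial.balanced {S : Servers n} {m : ℕ} {u₀ : ℝ} {c : Config n}
    (h : Initial u₀ c) : Balanced S m u₀ c := by
  obtain ⟨-, hmode, -, -, hu⟩ := h
  have hna : ∀ i, ¬ Active c i := fun i hi => hi (hmode i)
  constructor
  · exact fun i hi => absurd hi (hna i)
  · intro i hi; rw [hmode i] at hi; cases hi
  · exact fun i hi => absurd hi (hna i)
  · simp [activeU, hna, hu]
  · exact fun D k hk => absurd hk (hna k)

open Classical in
/-- Releasing a new server job, whose lag is zero, preserves the invariant. -/
theorem Balanced.release {S : Servers n} {m : ℕ} (hm : 1 ≤ m) {u₀ : ℝ} {c c' : Config n}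
    (h : Balanced S m u₀ c) (i : Fin n) (hi : Active c i → lag S c i = 0)
    (hnow : c'.now = c.now)
    (hmode : c'.mode = Function.update c.mode i Mode.activeContending)
    (hbud : c'.budget = Function.update c.budget i (S.Q i))
    (hdl : c'.deadline = Function.update c.deadline i (c.now + S.P i))
    (hu : c'.uInact = u₀ - activeU S c') : Balanced S m u₀ c' := by
  have hlag : lag S c' i = 0 := by
    simp [lag, hbud, hdl, hnow, Servers.Q, mul_comm]
  have hne : ∀ j, j ≠ i → lag S c' j = lag S c j ∧ (Active c' j ↔ Active c j) ∧
      c'.deadline j = c.deadline j ∧ c'.budget j = c.budget j ∧ c'.mode j = c.mode j := by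
    intro j hj
    simp [lag, Active, hbud, hdl, hnow, hmode, hj]
  have hsum : ∀ D, lagUpTo S c' D = lagUpTo S c D := by
    intro D
    refine Finset.sum_congr rfl fun j _ => ?_
    by_cases hj : j = i
    · subst hj
      rw [hlag, ite_self]
      split_ifs with hc
      · exact (hi hc.1).symm
      · rfl
    · obtain ⟨h1, h2, h3, -, -⟩ := hne j hj
      exact if_congr (by rw [h2, h3]) h1 rfl
  constructor
  · intro j hj
    by_cases hji : j = i
    · subst hji
      simpa [hbud, Servers.Q] using (mul_pos (S.U_pos j) (S.P_pos j)).le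
    · obtain ⟨-, h2, -, h4, -⟩ := hne j hji
      rw [h4]; exact h.budget_nonneg j (h2.1 hj)
  · intro j hj
    by_cases hji : j = i
    · subst hji; simp [hmode] at hj
    · obtain ⟨-, -, -, h4, h5⟩ := hne j hji
      rw [h4]; exact h.budget_recharging j (h5 ▸ hj)
  · intro j hj
    by_cases hji : j = i
    · subst hji
      simpa [hdl, hnow] using (S.P_pos j).le
    · obtain ⟨-, h2, h3, -, -⟩ := hne j hji
      rw [h3, hnow]; exact h.now_le j (h2.1 hj)
  · exact hu
  · intro D k hk hkD
    rw [hsum]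
    by_cases hki : k = i
    · subst hki
      rw [hlag, mul_zero, add_zero]
      exact h.lagUpTo_nonpos hm D
    · obtain ⟨h1, h2, h3, -, -⟩ := hne k hki
      rw [h1]; exact h.lag_le D k (h2.1 hk) (h3 ▸ hkD)

/-- Deactivating a server with nonnegative lag preserves the invariant. -/
theorem Balanced.deactivate {S : Servers n} {m : ℕ} {u₀ : ℝ} {c : Config n}
    (h : Balanced S m u₀ c) (i : Fin n) (hi : Active c i) (hlag : 0 ≤ lag S c i) :
    Balanced S m u₀ { c with
      mode := Function.update c.mode i Mode.inactive
      uInact := c.uInact + S.U i } := by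
  classical
  set c' : Config n := { c with
      mode := Function.update c.mode i Mode.inactive
      uInact := c.uInact + S.U i } with hc'
  have hact : ∀ j, Active c' j ↔ Active c j ∧ j ≠ i := by
    intro j
    by_cases hj : j = i
    · subst hj; simp [Active, hc']
    · simp [Active, hc', hj]
  -- The only summand that disappears is nonnegative.
  have hsum : ∀ D, lagUpTo S c' D ≤ lagUpTo S c D := by
    intro D
    refine Finset.sum_le_sum fun j _ => ?_
    change (if Active c' j ∧ c.deadline j ≤ D then lag S c j else 0) ≤ _
    by_cases hj : j = i
    · subst hj
      rw [if_neg fun hh => ((hact j).1 hh.1).2 rfl]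
      split_ifs
      · exact hlag
      · exact le_rfl
    · simp only [hact, hj, ne_eq, not_false_eq_true, and_true]; exact le_rfl
  constructor
  · exact fun j hj => h.budget_nonneg j ((hact j).1 hj).1
  · intro j hj
    by_cases hji : j = i
    · subst hji; simp [hc'] at hj
    · exact h.budget_recharging j (by simpa [hc', hji] using hj)
  · exact fun j hj => h.now_le j ((hact j).1 hj).1
  · have : activeU S c = activeU S c' + S.U i := by
      have hs : S.U i = ∑ j, if j = i then S.U i else 0 := by simp
      rw [hs, activeU, activeU, ← Finset.sum_add_distrib]
      refine Finset.sum_congr rfl fun j _ => ?_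
      by_cases hj : j = i
      · subst hj; simp [hact, hi]
      · simp [hact, hj]
    change c.uInact + S.U i = _
    rw [h.uInact_eq, this]; ring
  · intro D k hk hkD
    exact (add_le_add_left (hsum D) _).trans (h.lag_le D k ((hact k).1 hk).1 hkD)

/-! ### Passage of time under global EDF -/

theorem Servers.U_le_maxU (S : Servers n) (i : Fin n) : S.U i ≤ S.maxU :=
  le_ciSup (Set.finite_range S.U).bddAbove i

/-- If `U_inact` is initially small enough, then the rate of every server is bounded below in terms
of the bandwidth of the active servers. -/
theorem Balanced.le_mul_rate {S : Servers n} {m : ℕ} (hm : 1 ≤ m) {u₀ : ℝ}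
    (hu₀ : u₀ ≤ (m : ℝ) - ((m : ℝ) - 1) * S.maxU) {c : Config n}
    (h : Balanced S m u₀ c) (i : Fin n) :
    activeU S c + ((m : ℝ) - 1) * S.maxU ≤ m * rate S m c i := by
  have hm' : (0 : ℝ) < m := by exact_mod_cast hm
  have h1 : 1 - c.uInact / m ≤ rate S m c i := le_max_right _ _
  have h2 := mul_le_mul_of_nonneg_left h1 hm'.le
  have h3 : (m : ℝ) * (1 - c.uInact / m) = m - c.uInact := by field_simp
  rw [h3, h.uInact_eq] at h2
  linarith

theorem rate_pos (S : Servers n) (m : ℕ) (c : Config n) (i : Fin n) : 0 < rate S m c i :=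
  (S.U_pos i).trans_le (le_max_left _ _)

theorem MayElapse.mono {S : Servers n} {τ : Fin n → Task} {m : ℕ} {c : Config n}
    {R : Finset (Fin n)} {δ ε : ℝ} (h : MayElapse S τ m c R δ) (hε : 0 < ε) (hle : ε ≤ δ) :
    MayElapse S τ m c R ε := by
  obtain ⟨-, h1, h2, h3, h4, h5⟩ := h
  refine ⟨hε, fun i hi => ?_, h2, fun i hi => ⟨?_, fun r rest hq => ?_⟩, fun i hi => ?_,
    fun i hi => ?_⟩
  · linarith [h1 i hi]
  · exact (mul_le_mul_of_nonneg_left hle (rate_pos S m c i).le).trans (h3 i hi).1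
  · exact hle.trans ((h3 i hi).2 r rest hq)
  · refine (h4 i hi).trans (mul_le_mul_of_nonneg_right ?_ (S.U_pos i).le)
    linarith
  · linarith [h5 i hi]

theorem lag_elapse (S : Servers n) (m : ℕ) (c : Config n) (R : Finset (Fin n)) (δ : ℝ)
    (i : Fin n) :
    lag S (elapse S m c R δ) i =
      lag S c i + δ * S.U i - δ * if i ∈ R then rate S m c i else 0 := by
  by_cases hi : i ∈ R
  · simp only [lag, elapse, hi, if_true]; ring
  · simp only [lag, elapse, hi, if_false]; ring

-- The gain is bounded by the bandwidth of all active servers, whatever their deadlines, since this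
-- quantity governs the reclaiming rate. Executing servers outside `T` only lower the left side; `T`
-- is later `{k}` or `R`.
open Classical in
theorem lagUpTo_elapse_le (S : Servers n) (m : ℕ) (c : Config n) (R : Finset (Fin n)) {δ : ℝ}
    (hδ : 0 ≤ δ) (D : ℝ) (T : Finset (Fin n)) (hTR : T ⊆ R)
    (hT : ∀ i ∈ T, Active c i ∧ c.deadline i ≤ D) :
    lagUpTo S (elapse S m c R δ) D ≤
      lagUpTo S c D + δ * activeU S c - δ * ∑ i ∈ T, rate S m c i := by
  have hs : ∑ i ∈ T, rate S m c i = ∑ i, if i ∈ T then rate S m c i else 0 := by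
    rw [Finset.sum_ite_mem, Finset.univ_inter]
  rw [hs, lagUpTo, lagUpTo, activeU, Finset.mul_sum, Finset.mul_sum, ← Finset.sum_add_distrib,
    ← Finset.sum_sub_distrib]
  refine Finset.sum_le_sum fun i _ => ?_
  change (if Active c i ∧ c.deadline i ≤ D then lag S (elapse S m c R δ) i else 0) ≤ _
  have hr := mul_nonneg hδ (rate_pos S m c i).le
  have hU := mul_nonneg hδ (S.U_pos i).le
  rw [lag_elapse]
  by_cases hiT : i ∈ T
  · simp [hT i hiT, hiT, hTR hiT]
  · by_cases hiA : Active c i <;> by_cases hiD : c.deadline i ≤ D <;> by_cases hiR : i ∈ R <;>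
      simp [hiA, hiD, hiR, hiT, hr, hU]

/-- While global EDF executes, the weighted total lag of a contending server does not increase. -/
theorem Balanced.lag_elapse_le {S : Servers n} {m : ℕ} (hm : 1 ≤ m) {u₀ : ℝ}
    (hu₀ : u₀ ≤ (m : ℝ) - ((m : ℝ) - 1) * S.maxU) {c : Config n} (h : Balanced S m u₀ c)
    {R : Finset (Fin n)} (hR : IsGEDF m c R) {δ : ℝ} (hδ : 0 ≤ δ) {D : ℝ} {k : Fin n}
    (hk : c.mode k = Mode.activeContending) (hkD : c.deadline k ≤ D) :
    lagUpTo S (elapse S m c R δ) D + ((m : ℝ) - 1) * lag S (elapse S m c R δ) k ≤ 0 := by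
  have hm' : (0 : ℝ) ≤ (m : ℝ) - 1 := sub_nonneg.2 (by exact_mod_cast hm)
  have hact : ∀ i, c.mode i = Mode.activeContending → Active c i := fun i hi => by
    simp [Active, hi]
  have hΦ := h.lag_le D k (hact k hk) hkD
  have hUk := mul_le_mul_of_nonneg_left (S.U_le_maxU k) hm'
  rw [lag_elapse]
  by_cases hkR : k ∈ R
  -- The rate of `k` counts once in the total lag and `m - 1` times in its own weighted lag.
  · have hL := lagUpTo_elapse_le S m c R hδ D {k} (by simpa using hkR)
      (by simpa using ⟨hact k hk, hkD⟩)
    rw [Finset.sum_singleton] at hL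
    have hrate := h.le_mul_rate hm hu₀ k
    have : δ * (activeU S c + ((m : ℝ) - 1) * S.U k) ≤ δ * (m * rate S m c k) :=
      mul_le_mul_of_nonneg_left (by linarith) hδ
    rw [if_pos hkR]
    linarith
  -- All of `R` counts towards `D`, and each of its `m` rates supplies an `m`-th of the required
  -- decrease.
  · obtain ⟨hcard, hdl⟩ := hR.2.2 k hk hkR
    have hL := lagUpTo_elapse_le S m c R hδ D R subset_rfl
      fun i hi => ⟨hact i (hR.2.1 i hi), (hdl i hi).trans hkD⟩
    have hsum : (m : ℝ) * (activeU S c + ((m : ℝ) - 1) * S.maxU) ≤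
        m * ∑ i ∈ R, rate S m c i := by
      rw [Finset.mul_sum, ← hcard, ← nsmul_eq_mul, ← Finset.sum_const, hcard]
      exact Finset.sum_le_sum fun i _ => h.le_mul_rate hm hu₀ i
    have hsum' := le_of_mul_le_mul_left hsum (by exact_mod_cast hm : (0 : ℝ) < m)
    have : δ * (activeU S c + ((m : ℝ) - 1) * S.U k) ≤ δ * ∑ i ∈ R, rate S m c i :=
      mul_le_mul_of_nonneg_left (by linarith) hδ
    rw [if_neg hkR]
    linarith

theorem Balanced.budget_elapse_nonneg {S : Servers n} {τ : Fin n → Task} {m : ℕ} {u₀ : ℝ}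
    {c : Config n} (h : Balanced S m u₀ c) {R : Finset (Fin n)} {δ : ℝ}
    (hδ : MayElapse S τ m c R δ) (i : Fin n) (hi : Active c i) :
    0 ≤ (elapse S m c R δ).budget i := by
  by_cases hiR : i ∈ R
  · simpa [elapse, hiR] using (hδ.2.2.2.1 i hiR).1
  · simpa [elapse, hiR] using h.budget_nonneg i hi

/-- An active server that is not contending ends with nonpositive lag: by the deactivation
threshold, or, when recharging, by its zero budget. The deadline hypothesis is kept separate so that
a shortened run can be treated before `Balanced.now_add_le` is available. -/
theorem Balanced.elapse_of_now_le {S : Servers n} {τ : Fin n → Task} {m : ℕ} (hm : 1 ≤ m) {u₀ : ℝ}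
    (hu₀ : u₀ ≤ (m : ℝ) - ((m : ℝ) - 1) * S.maxU) {c : Config n} (h : Balanced S m u₀ c)
    {R : Finset (Fin n)} (hR : IsGEDF m c R) {δ : ℝ} (hδ : MayElapse S τ m c R δ)
    (hnow : ∀ k, Active c k → c.now + δ ≤ c.deadline k) :
    Balanced S m u₀ (elapse S m c R δ) := by
  have hm' : (0 : ℝ) ≤ (m : ℝ) - 1 := sub_nonneg.2 (by exact_mod_cast hm)
  have hrech : ∀ i, c.mode i = Mode.recharging → (elapse S m c R δ).budget i = 0 := by
    intro i hi
    have hiR : i ∉ R := fun hiR => by simp [hR.2.1 i hiR] at hi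
    simpa [elapse, hiR] using h.budget_recharging i hi
  have hlag : ∀ k, Active c k → c.mode k ≠ Mode.activeContending →
      lag S (elapse S m c R δ) k ≤ 0 := by
    intro k hk hkc
    have hkR : k ∉ R := fun hkR => hkc (hR.2.1 k hkR)
    cases hmk : c.mode k with
    | activeContending => exact absurd hmk hkc
    | inactive => exact absurd hmk hk
    | activeNonContending =>
      have := hδ.2.2.2.2.1 k hmk
      simpa [lag, elapse, hkR] using this
    | recharging =>
      have h1 := hrech k hmk
      have h2 : 0 ≤ (c.deadline k - (c.now + δ)) * S.U k :=
        mul_nonneg (sub_nonneg.2 (hnow k hk)) (S.U_pos k).le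
      rw [lag, h1]
      simpa [elapse] using h2
  refine ⟨fun i hi => h.budget_elapse_nonneg hδ i hi, hrech, hnow, h.uInact_eq, ?_⟩
  intro D k hk hkD
  by_cases hkc : c.mode k = Mode.activeContending
  · exact h.lag_elapse_le hm hu₀ hR hδ.1.le hkc hkD
  · have hL : lagUpTo S (elapse S m c R δ) D ≤ 0 := by
      refine lagUpTo_nonpos_of_forall hm fun j hj hjD hpos => ?_
      have hjc : c.mode j = Mode.activeContending := by
        by_contra hjc
        exact absurd (hlag j hj hjc) (not_le.2 hpos)
      exact h.lag_elapse_le hm hu₀ hR hδ.1.le hjc hjD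
    have := mul_nonpos_of_nonneg_of_nonpos hm' (hlag k hk hkc)
    linarith

/-- No deadline is passed while time elapses. -/
theorem Balanced.now_add_le {S : Servers n} {τ : Fin n → Task} {m : ℕ} (hm : 1 ≤ m) {u₀ : ℝ}
    (hu₀ : u₀ ≤ (m : ℝ) - ((m : ℝ) - 1) * S.maxU) {c : Config n} (h : Balanced S m u₀ c)
    {R : Finset (Fin n)} (hR : IsGEDF m c R) {δ : ℝ} (hδ : MayElapse S τ m c R δ)
    (k : Fin n) (hk : Active c k) : c.now + δ ≤ c.deadline k := by
  classical
  by_contra! hlt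
  -- With the earliest active deadline, the run cut there passes no deadline.
  obtain ⟨j, hj, hmin⟩ := Finset.exists_min_image (Finset.univ.filter (Active c)) c.deadline
    ⟨k, by simpa using hk⟩
  simp only [Finset.mem_filter, Finset.mem_univ, true_and] at hj hmin
  have hjlt : c.deadline j < c.now + δ := (hmin k hk).trans_lt hlt
  have hjc : c.mode j = Mode.activeContending := by
    cases hmj : c.mode j with
    | activeContending => rfl
    | inactive => exact absurd hmj hj
    | activeNonContending =>
      have h1 := (h.budget_nonneg j hj).trans (hδ.2.2.2.2.1 j hmj)
      have h2 := nonneg_of_mul_nonneg_left h1 (S.U_pos j)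
      linarith
    | recharging => exact absurd (hδ.2.2.2.2.2 j hmj) (not_le.2 hjlt)
  have hbpos := (hδ.2.2.1 j hjc).1
  set ε : ℝ := c.deadline j - c.now with hε
  have hεpos : 0 < ε := sub_pos.2 ((h.meetsDeadline hm j hjc).2 hbpos)
  have hεlt : ε < δ := by linarith
  have hbal := h.elapse_of_now_le hm hu₀ hR (hδ.mono hεpos hεlt.le) fun i hi => by
    linarith [hmin i hi]
  have hmeet := (hbal.meetsDeadline hm j hjc).2
  -- The budget lasts until `δ > ε`, so it is positive at the cut, where the invariant would make it
  -- zero.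
  have hpos : 0 < (elapse S m c R ε).budget j := by
    by_cases hjR : j ∈ R
    · have h1 := (hδ.2.2.2.1 j hjR).1
      have h2 := mul_lt_mul_of_pos_left hεlt (rate_pos S m c j)
      simpa [elapse, hjR] using h2.trans_le h1
    · simpa [elapse, hjR] using hbpos
  have hnow := hmeet hpos
  simp only [elapse] at hnow
  linarith

theorem Balanced.step {S : Servers n} {τ : Fin n → Task} {m : ℕ} (hm : 1 ≤ m) {u₀ : ℝ}
    (hu₀ : u₀ ≤ (m : ℝ) - ((m : ℝ) - 1) * S.maxU) {c c' : Config n} (h : Balanced S m u₀ c)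
    (hstep : Step S τ m c c') : Balanced S m u₀ c' := by
  classical
  have hupd : ∀ (i : Fin n) (s : Mode), s ≠ Mode.inactive → c.mode i ≠ Mode.inactive →
      ∀ j, Function.update c.mode i s j ≠ Mode.inactive ↔ c.mode j ≠ Mode.inactive := by
    intro i s hs hi j
    by_cases hj : j = i
    · subst hj; simp [hs, hi]
    · simp [hj]
  have hupdr : ∀ (i : Fin n) (s : Mode), (s = Mode.recharging → c.budget i = 0) →
      ∀ j, Function.update c.mode i s j = Mode.recharging → c.budget j = 0 := by
    intro i s hs j hj
    by_cases hji : j = i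
    · subst hji; exact hs (by simpa using hj)
    · exact h.budget_recharging j (by simpa [hji] using hj)
  cases hstep with
  | activate i ha hs =>
    refine h.release hm i (fun hi => absurd hs hi) rfl rfl rfl rfl ?_
    have : ∀ c' : Config n, c'.mode = Function.update c.mode i Mode.activeContending →
        activeU S c' = activeU S c + S.U i := by
      intro c' hc'
      have hsum : S.U i = ∑ j, if j = i then S.U i else 0 := by simp
      rw [hsum, activeU, activeU, ← Finset.sum_add_distrib]
      refine Finset.sum_congr rfl fun j _ => ?_
      by_cases hj : j = i
      · subst hj; simp [Active, hc', hs]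
      · rw [if_neg hj, add_zero]
        exact if_congr (by simp [Active, hc', hj]) rfl rfl
    rw [this _ rfl, ← sub_sub, ← h.uInact_eq]
  | resume i ha hs =>
    exact h.congr rfl rfl rfl rfl (hupd i _ (by simp) (by simp [hs])) (hupdr i _ (by simp))
  | queueUp i ha hs =>
    exact h.congr rfl rfl rfl rfl (fun _ => Iff.rfl) h.budget_recharging
  | completeNext i r rest hs hq =>
    exact h.congr rfl rfl rfl rfl (fun _ => Iff.rfl) h.budget_recharging
  | completeLast i hs hq =>
    exact h.congr rfl rfl rfl rfl (hupd i _ (by simp) (by simp [hs])) (hupdr i _ (by simp))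
  | exhaust i r rest hs hq hr hb =>
    exact h.congr rfl rfl rfl rfl (hupd i _ (by simp) (by simp [hs])) (hupdr i _ fun _ => hb)
  | recharge i hs hd =>
    have hi : Active c i := by simp [Active, hs]
    -- Recharging happens exactly at the deadline, so the old lag is zero and the new deadline is
    -- one period from now.
    have hdn : c.deadline i = c.now := le_antisymm hd (h.now_le i hi)
    refine h.release hm i (fun _ => ?_) rfl rfl rfl (by rw [hdn]) ?_
    · simp [lag, hdn, h.budget_recharging i hs]
    · change c.uInact = _
      rw [h.uInact_eq]
      exact congrArg (u₀ - ·)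
        (activeU_congr (hupd i Mode.activeContending (by simp) hi)).symm
  | deactivate i hs hb =>
    exact h.deactivate i (by simp [Active, hs]) (sub_nonneg.2 hb)
  | run R δ hR hδ =>
    exact h.elapse_of_now_le hm hu₀ hR hδ (h.now_add_le hm hu₀ hR hδ)

theorem Reachable.balanced {S : Servers n} {τ : Fin n → Task} {m : ℕ} (hm : 1 ≤ m) {u₀ : ℝ}
    (hu₀ : u₀ ≤ (m : ℝ) - ((m : ℝ) - 1) * S.maxU) {c : Config n}
    (hc : Reachable S τ m u₀ c) : Balanced S m u₀ c := by
  obtain ⟨c₀, h₀, hsteps⟩ := hc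
  induction hsteps with
  | refl => exact h₀.balanced
  | tail _ hstep ih => exact ih.step hm hu₀ hstep

end ParRecl

theorem mainTheorem1 (n m : ℕ) (hm : 1 ≤ m) (S : ParRecl.Servers n)
    (hGFB : S.GFB m)
    (u₀ : ℝ) (hu₀ : u₀ ≤ (m : ℝ) - ((m : ℝ) - 1) * S.maxU)
    (τ : Fin n → ParRecl.Task)
    (c : ParRecl.Config n) (hc : ParRecl.Reachable S τ m u₀ c) (i : Fin n) :
    ParRecl.MeetsDeadline c i := by
  exact (ParRecl.Reachable.balanced hm hu₀ hc).meetsDeadline hm i
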